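/- There are absolute constants $c_1,c_2,C>0$ with the following property. Let $d\ge 2$ be an integer and let $\mathbb F_q$ be the finite field with $q=p^r$ elements, where either $d\equiv 0\pmod 4$, or $d\equiv 2\pmod 4$ and $q\equiv 1\pmod 4$. Let $s\in\left[\frac{d+2}{4d},\frac12\right]$. Then for every real $\varepsilon$ with $\frac1q\le\varepsilon\le 1$ there is a set $E\subseteq\mathbb F_q^d$ such that 1. $E$ is a $(4,s)$-Salem set with constant $C$: for every nontrivial additive character $\chi$ of $\mathbb F_q$, the Fourier transform $\widehat E(\mathbf x)=q^{-d}\sum_{\mathbf y\in E}\chi(-\mathbf x\cdot\mathbf y)$ satisfies $$\Big(q^{-d}\sum_{\mathbf x\in\mathbb F_q^d\setminus\{\mathbf 0\}}|\widehat E(\mathbf x)|^4\Big)^{1/4}\le C\,q^{-d}|E|^{1-s};$$ 2. $c_1\,\varepsilon^{\frac1{2s}}\,q^{\frac{d+2}{8s}}\le |E|\le c_2\,\varepsilon^{\frac1{2s}}\,q^{\frac{d+2}{8s}}$; 3. $|\Delta(E)|\le\varepsilon q$, where $\Delta(E)=\{\|\mathbf x-\mathbf y\|:\mathbf x,\mathbf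 y\in E\}$ and $\|\mathbf x\|=x_1^2+\dots+x_d^2$. (So, for each fixed $\varepsilon>0$, $|E|\sim q^{\frac{d+2}{8s}}$ with implied constants depending only on $\varepsilon$, while $E$ determines at most a proportion $\varepsilon$ of all distances. If $\varepsilon=\varepsilon(q)\to0$ more slowly than every negative power of $q$, then $|E|=q^{\frac{d+2}{8s}+o(1)}$ and $|\Delta(E)|=o(q)$. With $\varepsilon=1/p$ and $\alpha=1-\frac1r$, $|E|\sim q^{\frac{d+4\alpha-2}{8s}}$ and $|\Delta(E)|\le q^{\alpha}$.) -/

import Mathlib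

/-- The standard quadratic form `x₁² + ⋯ + x_d²` on `F^d`. -/
def quadNorm {F : Type*} [Field F] {d : ℕ} (x : Fin d → F) : F :=
  ∑ i, x i ^ 2

/-- The set of distances `‖x - y‖`, for `x`, `y` in `E`. -/
def distanceSet {F : Type*} [Field F] {d : ℕ} (E : Finset (Fin d → F)) : Set F :=
  {t | ∃ x ∈ E, ∃ y ∈ E, quadNorm (x - y) = t}

/-- The Fourier transform `q^{-d} ∑_{y ∈ E} χ(- x · y)` of (the indicator function of) `E`,
with respect to the additive character `χ`; here `q` is the cardinality of `F`. -/
noncomputable def fourierHat {F : Type*} [Field F] [Fintype F] {d : ℕ} (χ : AddChar F ℂ)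
    (E : Finset (Fin d → F)) (x : Fin d → F) : ℂ :=
  ((Fintype.card F : ℂ) ^ d)⁻¹ * ∑ y ∈ E, χ (-(x ⬝ᵥ y))

open scoped Classical in
/-- The norm `(q^{-d} ∑_{x ≠ 0} |Ê(x)|^u)^{1/u}`, for a finite exponent `u ≥ 1`. -/
noncomputable def fourierNorm {F : Type*} [Field F] [Fintype F] {d : ℕ} (χ : AddChar F ℂ) (u : ℝ)
    (E : Finset (Fin d → F)) : ℝ :=
  (((Fintype.card F : ℝ) ^ d)⁻¹ *
    ∑ x ∈ Finset.univ.filter (fun x : Fin d → F => x ≠ 0), ‖fourierHat χ E x‖ ^ u) ^ (1 / u)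

/-- `E` is a `(u, s)`-Salem set with implied constant `C`: for every nontrivial additive
character, `‖Ê‖_u ≤ C q^{-d} |E|^{1-s}`. -/
def IsSalemWith {F : Type*} [Field F] [Fintype F] {d : ℕ} (C u s : ℝ)
    (E : Finset (Fin d → F)) : Prop :=
  ∀ χ : AddChar F ℂ, χ ≠ 1 →
    fourierNorm χ u E ≤ C * ((Fintype.card F : ℝ) ^ d)⁻¹ * (E.card : ℝ) ^ (1 - s)

/-!
By orthogonality of characters, the sum of `|Ê|⁴` over all frequencies is `q^{-3d}` times the
additive energy of `E`. So `E` is a `(4, s)`-Salem set as soon as its energy is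
`O(|E|^{4 - 4s})` (`isSalemWith_of_addEnergy_le`), and the frequency `0` may be included.

Let `d = 2n`. If `n` is even, use that `-1` is a sum of two squares in `F`; if `n` is odd, then
`q ≡ 1 mod 4` and `-1` is a square. In both cases `F^{n-1} × F × F` embeds into `F^d` so that the
quadratic form becomes `κ x y`, where `κ = 4`, or `κ = 0` in characteristic two
(`exists_embedding_hyperbolic`); in particular the factor `F^{n-1}` is totally isotropic.
The set is `E = S × G`. Here `G` is a geometric
progression `(gⁱ, g⁻ⁱ)`, `i < N`, on the hyperbola `x y = 1`, with `N` about `ε q`: its differences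
have at most `N` values of `x y` (`ncard_distanceSet_image_le`), and its energy is at most `3 N²`
(`addEnergy_hyperbola_le`). The factor `S` lies in the isotropic part, so it does not affect
distances. It has the energy of a random set, at most `12 k² + 8 k⁴ / q^{n-1}` for `|S| = k`
(`exists_card_eq_addEnergy_le`). Energy is multiplicative on products, so the energy of `E` is
`O(|E|² + |E|⁴ / (N² q^{n-1}))`. The first term is admissible because `s ≤ 1/2`. The second is
admissible exactly when `|E|^{4s} ≪ ε² q^{n+1}`, which is the prescribed size
(`exists_factor_sizes`).
-/

/-! ### Additive energy -/

open scoped Combinatorics.Additive in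
theorem addEnergy_product {α β : Type*} [Add α] [Add β] [DecidableEq α] [DecidableEq β]
    (S : Finset α) (T : Finset β) : E[S ×ˢ T] = E[S] * E[T] := by
  unfold Finset.addEnergy
  rw [← Finset.card_product]
  refine Finset.card_nbij'
    (fun z => (((z.1.1.1, z.1.2.1), (z.2.1.1, z.2.2.1)), ((z.1.1.2, z.1.2.2), (z.2.1.2, z.2.2.2))))
    (fun z => (((z.1.1.1, z.2.1.1), (z.1.1.2, z.2.1.2)), ((z.1.2.1, z.2.2.1), (z.1.2.2, z.2.2.2))))
    ?_ ?_ ?_ ?_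
  · rintro ⟨⟨⟨a, b⟩, ⟨c, d⟩⟩, ⟨⟨e, f⟩, ⟨g, h⟩⟩⟩
    simp
    tauto
  · rintro ⟨⟨⟨a, b⟩, ⟨c, d⟩⟩, ⟨⟨e, f⟩, ⟨g, h⟩⟩⟩
    simp
    tauto
  · rintro ⟨⟨⟨a, b⟩, ⟨c, d⟩⟩, ⟨⟨e, f⟩, ⟨g, h⟩⟩⟩ _
    rfl
  · rintro ⟨⟨⟨a, b⟩, ⟨c, d⟩⟩, ⟨⟨e, f⟩, ⟨g, h⟩⟩⟩ _
    rfl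

open scoped Combinatorics.Additive in
theorem addEnergy_image {α β : Type*} [AddCommGroup α] [AddCommGroup β] [DecidableEq α]
    [DecidableEq β] (φ : α →+ β) (hφ : Function.Injective φ) (S : Finset α) :
    E[S.image φ] = E[S] := by
  symm
  unfold Finset.addEnergy
  refine Finset.card_nbij (Prod.map (Prod.map φ φ) (Prod.map φ φ)) ?_ ?_ ?_
  · rintro ⟨⟨a, b⟩, ⟨c, d⟩⟩ h
    simp only [Finset.coe_filter, Finset.mem_product, Set.mem_ofPred_eq] at h
    obtain ⟨⟨⟨ha, hb⟩, hc, hd⟩, h⟩ := h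
    simp only [Finset.coe_filter, Finset.mem_product, Set.mem_ofPred_eq, Prod.map]
    exact ⟨⟨⟨Finset.mem_image_of_mem _ ha, Finset.mem_image_of_mem _ hb⟩,
      Finset.mem_image_of_mem _ hc, Finset.mem_image_of_mem _ hd⟩, by
        rw [← map_add, ← map_add, h]⟩
  · exact ((hφ.prodMap hφ).prodMap (hφ.prodMap hφ)).injOn
  · rintro ⟨⟨a, b⟩, ⟨c, d⟩⟩ h
    simp only [Finset.coe_filter, Finset.mem_product, Set.mem_ofPred_eq, Finset.mem_image] at h
    obtain ⟨⟨⟨⟨a, ha, rfl⟩, ⟨b, hb, rfl⟩⟩, ⟨c, hc, rfl⟩, ⟨d, hd, rfl⟩⟩, h⟩ := h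
    refine ⟨((a, b), (c, d)), ?_, rfl⟩
    simp only [Finset.coe_filter, Finset.mem_product, Set.mem_ofPred_eq]
    refine ⟨⟨⟨ha, hb⟩, hc, hd⟩, hφ ?_⟩
    rw [map_add, map_add, h]

open scoped Combinatorics.Additive in
/-- Adding one point `x` creates few additive quadruples: up to symmetry `x` occupies the first
position, and then either the quadruple is trivial, or it is determined by one further point, or
it is a representation of `x` as `c + d - b` with `b`, `c`, `d` in `S`. -/
theorem addEnergy_insert_le {α : Type*} [AddCommGroup α] [DecidableEq α] (S : Finset α) (x : α) :
    E[insert x S] ≤ E[S] + 4 * (3 * (S.card + 1) +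
      ((S ×ˢ S ×ˢ S).filter (fun t => t.2.1 + t.2.2 - t.1 = x)).card) := by
  set S' := insert x S with hS'
  set R := (S ×ˢ S ×ˢ S).filter (fun t => t.2.1 + t.2.2 - t.1 = x) with hR
  set T := (S' ×ˢ S' ×ˢ S').filter (fun t => x + t.1 = t.2.1 + t.2.2) with hT
  have hS'c : S'.card ≤ S.card + 1 := Finset.card_insert_le _ _
  have hTc : T.card ≤ 3 * (S.card + 1) + R.card := by
    have hsub : T ⊆ S'.image (fun b => (b, x, b)) ∪ (S'.image (fun b => (b, b, x)) ∪
        (S'.image (fun c => (x, c, x + x - c)) ∪ R)) := by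
      rintro ⟨b, c, d⟩ h
      simp only [hT, Finset.mem_filter, Finset.mem_product] at h
      obtain ⟨⟨hb, hc, hd⟩, h⟩ := h
      simp only [Finset.mem_union, Finset.mem_image, Prod.mk.injEq]
      by_cases hcx : c = x
      · subst hcx
        exact Or.inl ⟨b, hb, rfl, rfl, add_left_cancel h⟩
      by_cases hdx : d = x
      · subst hdx
        refine Or.inr (Or.inl ⟨b, hb, rfl, ?_, rfl⟩)
        rw [add_comm c] at h
        exact add_left_cancel h
      refine Or.inr (Or.inr ?_)
      by_cases hbx : b = x
      · subst hbx
        exact Or.inl ⟨c, hc, rfl, rfl, by rw [h]; abel⟩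
      · right
        simp only [hR, Finset.mem_filter, Finset.mem_product]
        exact ⟨⟨Finset.mem_of_mem_insert_of_ne hb hbx, Finset.mem_of_mem_insert_of_ne hc hcx,
          Finset.mem_of_mem_insert_of_ne hd hdx⟩, by rw [← h]; abel⟩
    have h1 := Finset.card_le_card hsub
    have h2 := Finset.card_union_le (S'.image (fun b => (b, x, b)))
      (S'.image (fun b => (b, b, x)) ∪ (S'.image (fun c => (x, c, x + x - c)) ∪ R))
    have h3 := Finset.card_union_le (S'.image (fun b => (b, b, x)))
      (S'.image (fun c => (x, c, x + x - c)) ∪ R)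
    have h4 := Finset.card_union_le (S'.image (fun c => (x, c, x + x - c))) R
    have h5 := Finset.card_image_le (s := S') (f := fun b => (b, x, b))
    have h6 := Finset.card_image_le (s := S') (f := fun b => (b, b, x))
    have h7 := Finset.card_image_le (s := S') (f := fun c => (x, c, x + x - c))
    omega
  unfold Finset.addEnergy
  set Q := ((S ×ˢ S) ×ˢ S ×ˢ S).filter (fun t => t.1.1 + t.2.1 = t.1.2 + t.2.2) with hQ
  have hsub : ((S' ×ˢ S') ×ˢ S' ×ˢ S').filter (fun t => t.1.1 + t.2.1 = t.1.2 + t.2.2) ⊆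
      Q ∪ (T.image (fun t => ((x, t.2.1), (t.1, t.2.2))) ∪
      (T.image (fun t => ((t.1, t.2.1), (x, t.2.2))) ∪
      (T.image (fun t => ((t.2.1, x), (t.2.2, t.1))) ∪
      T.image (fun t => ((t.2.1, t.1), (t.2.2, x)))))) := by
    rintro ⟨⟨a, b⟩, ⟨c, d⟩⟩ h
    simp only [Finset.mem_filter, Finset.mem_product] at h
    obtain ⟨⟨⟨ha, hb⟩, hc, hd⟩, h⟩ := h
    simp only [Finset.mem_union, Finset.mem_image]
    by_cases hax : a = x
    · refine Or.inr (Or.inl ⟨(c, b, d), ?_, by simp [hax]⟩)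
      simp only [hT, Finset.mem_filter, Finset.mem_product]
      exact ⟨⟨hc, hb, hd⟩, by rw [← hax, h]⟩
    by_cases hcx : c = x
    · refine Or.inr (Or.inr (Or.inl ⟨(a, b, d), ?_, by simp [hcx]⟩))
      simp only [hT, Finset.mem_filter, Finset.mem_product]
      exact ⟨⟨ha, hb, hd⟩, by rw [← hcx, ← h, add_comm]⟩
    by_cases hbx : b = x
    · refine Or.inr (Or.inr (Or.inr (Or.inl ⟨(d, a, c), ?_, by simp [hbx]⟩)))
      simp only [hT, Finset.mem_filter, Finset.mem_product]
      exact ⟨⟨hd, ha, hc⟩, by rw [← hbx, h]⟩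
    by_cases hdx : d = x
    · refine Or.inr (Or.inr (Or.inr (Or.inr ⟨(b, a, c), ?_, by simp [hdx]⟩)))
      simp only [hT, Finset.mem_filter, Finset.mem_product]
      exact ⟨⟨hb, ha, hc⟩, by rw [← hdx, h, add_comm]⟩
    · left
      simp only [hQ, Finset.mem_filter, Finset.mem_product]
      exact ⟨⟨⟨Finset.mem_of_mem_insert_of_ne ha hax, Finset.mem_of_mem_insert_of_ne hb hbx⟩,
        Finset.mem_of_mem_insert_of_ne hc hcx, Finset.mem_of_mem_insert_of_ne hd hdx⟩, h⟩
  refine (Finset.card_le_card hsub).trans ?_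
  refine (Finset.card_union_le _ _).trans (Nat.add_le_add_left ?_ _)
  have hi : ∀ f : α × α × α → (α × α) × α × α,
      (T.image f).card ≤ 3 * (S.card + 1) + R.card :=
    fun f => Finset.card_image_le.trans hTc
  refine (Finset.card_union_le _ _).trans ?_
  refine (Nat.add_le_add (hi _) ((Finset.card_union_le _ _).trans
    (Nat.add_le_add (hi _) ((Finset.card_union_le _ _).trans
      (Nat.add_le_add (hi _) (hi _)))))).trans ?_
  omega

open scoped Combinatorics.Additive in
/-- A finite abelian group of order `n` contains a set of `k` elements whose energy is at most
`12 k² + 8 k⁴ / n`, as for a random set. The set is built greedily, each new point being one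
with at most the average number of representations as `c + d - b`. -/
theorem exists_card_eq_addEnergy_le (α : Type*) [AddCommGroup α] [Fintype α] [DecidableEq α]
    (k : ℕ) (hk : 2 * k ≤ Fintype.card α + 2) :
    ∃ S : Finset α, S.card = k ∧
      Fintype.card α * E[S] ≤ 12 * Fintype.card α * k ^ 2 + 8 * k ^ 4 := by
  induction k with
  | zero => exact ⟨∅, by simp⟩
  | succ j ih =>
    obtain ⟨S, hSc, hSE⟩ := ih (by omega)
    set n := Fintype.card α with hn
    have hn0 : 0 < n := Fintype.card_pos
    let r : α → ℕ := fun x =>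
      ((S ×ˢ S ×ˢ S).filter (fun t => t.2.1 + t.2.2 - t.1 = x)).card
    have hcompl : Sᶜ.card = n - j := by rw [Finset.card_compl, hSc]
    have hsum : ∑ x ∈ Sᶜ, r x ≤ j ^ 3 := by
      calc ∑ x ∈ Sᶜ, r x ≤ ∑ x, r x :=
            Finset.sum_le_sum_of_subset (Finset.subset_univ _)
        _ = (S ×ˢ S ×ˢ S).card :=
            (Finset.card_eq_sum_card_fiberwise
              (fun _ _ => Finset.mem_coe.2 (Finset.mem_univ _))).symm
        _ = j ^ 3 := by rw [Finset.card_product, Finset.card_product, hSc]; ring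
    obtain ⟨x, hx, hxr⟩ : ∃ x ∈ Sᶜ, n * r x ≤ 2 * j ^ 3 := by
      apply Finset.exists_le_of_sum_le
      · rw [← Finset.card_pos, hcompl]; omega
      · rw [← Finset.mul_sum, Finset.sum_const, hcompl, smul_eq_mul]
        calc n * ∑ x ∈ Sᶜ, r x ≤ n * j ^ 3 := Nat.mul_le_mul_left _ hsum
          _ ≤ (2 * (n - j)) * j ^ 3 := Nat.mul_le_mul_right _ (by omega)
          _ = (n - j) * (2 * j ^ 3) := by ring
    refine ⟨insert x S, ?_, ?_⟩
    · rw [Finset.card_insert_of_notMem (Finset.mem_compl.1 hx), hSc]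
    · have h1 := Nat.mul_le_mul_left n (addEnergy_insert_le S x)
      rw [hSc] at h1
      change _ ≤ n * (E[S] + 4 * (3 * (j + 1) + r x)) at h1
      calc n * E[insert x S] ≤ n * E[S] + 12 * n * (j + 1) + 4 * (n * r x) := by
            linarith
        _ ≤ (12 * n * j ^ 2 + 8 * j ^ 4) + 12 * n * (j + 1) + 4 * (2 * j ^ 3) := by gcongr
        _ ≤ 12 * n * (j + 1) ^ 2 + 8 * (j + 1) ^ 4 := by
            have : 12 * n * (j + 1) ^ 2 + 8 * (j + 1) ^ 4 =
              (12 * n * j ^ 2 + 8 * j ^ 4) + 12 * n * (j + 1) + 4 * (2 * j ^ 3) +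
              (12 * n * j + 24 * j ^ 3 + 48 * j ^ 2 + 32 * j + 8) := by ring
            omega

open scoped Combinatorics.Additive in
/-- If `t + u` and `t⁻¹ + u⁻¹` are known and `t + u ≠ 0`, then `t u` is known, hence so is
`{t, u}`; the quadruples with `t + u = 0` are determined by two of their entries. So a subset of
the hyperbola `x y = 1` has nearly minimal energy. -/
theorem addEnergy_hyperbola_le {F : Type*} [Field F] [DecidableEq F] (G : Finset Fˣ) :
    E[G.image (fun t : Fˣ => ((t : F), ((t⁻¹ : Fˣ) : F)))] ≤ 3 * G.card ^ 2 := by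
  set f : Fˣ → F × F := fun t => ((t : F), ((t⁻¹ : Fˣ) : F)) with hf
  have hsub : (((G.image f ×ˢ G.image f) ×ˢ G.image f ×ˢ G.image f).filter
      (fun t => t.1.1 + t.2.1 = t.1.2 + t.2.2)) ⊆
      (G ×ˢ G).image (fun z => ((f z.1, f z.1), (f z.2, f z.2))) ∪
      ((G ×ˢ G).image (fun z => ((f z.1, f z.2), (f z.2, f z.1))) ∪
      (G ×ˢ G).image (fun z => ((f z.1, f z.2), (-f z.1, -f z.2)))) := by
    rintro ⟨⟨a, b⟩, ⟨c, d⟩⟩ h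
    simp only [Finset.mem_filter, Finset.mem_product, Finset.mem_image] at h
    obtain ⟨⟨⟨⟨a, ha, rfl⟩, ⟨b, hb, rfl⟩⟩, ⟨c, hc, rfl⟩, ⟨d, hd, rfl⟩⟩, h⟩ := h
    have h1 : (a : F) + c = b + d := congrArg Prod.fst h
    have h2 : (a : F)⁻¹ + (c : F)⁻¹ = (b : F)⁻¹ + (d : F)⁻¹ := by
      simpa [hf] using congrArg Prod.snd h
    have ha0 := a.ne_zero
    have hb0 := b.ne_zero
    have hc0 := c.ne_zero
    have hd0 := d.ne_zero
    simp only [Finset.mem_union, Finset.mem_image]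
    by_cases hs : (a : F) + c = 0
    · have hca : c = -a := Units.ext (by rw [Units.val_neg]; linear_combination hs)
      have hdb : d = -b := Units.ext (by rw [Units.val_neg]; linear_combination hs - h1)
      refine Or.inr (Or.inr ⟨(a, b), by simp [ha, hb], ?_⟩)
      simp [hf, hca, hdb, inv_neg]
    · have h3 : ((a : F) + c) * (b * d) = (a + c) * (a * c) := by
        field_simp at h2
        linear_combination h2 + (a : F) * c * (- h1)
      have h4 : (b : F) * d = a * c := mul_left_cancel₀ hs h3
      have h5 : ((a : F) - b) * (a - d) = 0 := by linear_combination (a : F) * h1 + h4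
      rcases mul_eq_zero.1 h5 with h6 | h6
      · have hab : a = b := Units.ext (sub_eq_zero.1 h6)
        subst hab
        have hcd : c = d := Units.ext (add_left_cancel h1)
        subst hcd
        exact Or.inl ⟨(a, c), by simp [ha, hc], rfl⟩
      · have had : a = d := Units.ext (sub_eq_zero.1 h6)
        subst had
        have hcb : c = b := Units.ext (by linear_combination h1)
        subst hcb
        exact Or.inr (Or.inl ⟨(a, c), by simp [ha, hc], rfl⟩)
  have hi : ∀ g : Fˣ × Fˣ → (((F × F) × (F × F)) × (F × F) × (F × F)),
      ((G ×ˢ G).image g).card ≤ G.card ^ 2 := fun g =>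
    Finset.card_image_le.trans (by rw [Finset.card_product, sq])
  unfold Finset.addEnergy
  refine (Finset.card_le_card hsub).trans ((Finset.card_union_le _ _).trans ?_)
  refine (Nat.add_le_add (hi _) ((Finset.card_union_le _ _).trans
    (Nat.add_le_add (hi _) (hi _)))).trans ?_
  omega

/-! ### The fourth moment of the Fourier transform -/

theorem sum_addChar_dotProduct {F : Type*} [Field F] [Fintype F] [DecidableEq F] {d : ℕ}
    {χ : AddChar F ℂ} (hχ : χ ≠ 1) (v : Fin d → F) :
    ∑ x : Fin d → F, χ (x ⬝ᵥ v) = if v = 0 then (Fintype.card F : ℂ) ^ d else 0 := by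
  classical
  let ψ : AddChar (Fin d → F) ℂ :=
    { toFun := fun x => χ (x ⬝ᵥ v)
      map_zero_eq_one' := by simp
      map_add_eq_mul' := fun x y => by rw [add_dotProduct, AddChar.map_add_eq_mul] }
  have hψ : ψ = 0 ↔ v = 0 := by
    constructor
    · intro h
      by_contra hv
      obtain ⟨i, hi⟩ := Function.ne_iff.1 hv
      apply hχ
      ext t
      have h1 : ψ (Pi.single i (t / v i)) = 1 := by rw [h]; rfl
      change χ (Pi.single i (t / v i) ⬝ᵥ v) = 1 at h1
      rw [single_dotProduct, div_mul_cancel₀ _ hi] at h1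
      simpa using h1
    · rintro rfl
      ext x
      change χ (x ⬝ᵥ 0) = 1
      simp
  have h2 := AddChar.sum_eq_ite ψ
  change ∑ x, χ (x ⬝ᵥ v) = _ at h2
  rw [h2]
  simp [hψ]

open scoped Combinatorics.Additive ComplexConjugate in
/-- Expanding the fourth power and using orthogonality of characters, the fourth moment counts
additive quadruples. -/
theorem sum_norm_sum_addChar_pow_four {F : Type*} [Field F] [Fintype F] [DecidableEq F] {d : ℕ}
    {χ : AddChar F ℂ} (hχ : χ ≠ 1) (E : Finset (Fin d → F)) :
    ∑ x : Fin d → F, ‖∑ y ∈ E, χ (-(x ⬝ᵥ y))‖ ^ 4 = (Fintype.card F : ℝ) ^ d * E[E] := by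
  have key : ∀ x : Fin d → F, ((‖∑ y ∈ E, χ (-(x ⬝ᵥ y))‖ ^ 4 : ℝ) : ℂ) =
      ∑ z ∈ (E ×ˢ E) ×ˢ E ×ˢ E, χ (x ⬝ᵥ ((z.1.1 + z.2.1) - (z.1.2 + z.2.2))) := by
    intro x
    have h1 : ((‖∑ y ∈ E, χ (-(x ⬝ᵥ y))‖ ^ 4 : ℝ) : ℂ) =
        ((∑ y ∈ E, χ (x ⬝ᵥ y)) * ∑ y ∈ E, χ (-(x ⬝ᵥ y))) *
        ((∑ y ∈ E, χ (x ⬝ᵥ y)) * ∑ y ∈ E, χ (-(x ⬝ᵥ y))) := by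
      have h2 : ∑ y ∈ E, χ (x ⬝ᵥ y) = conj (∑ y ∈ E, χ (-(x ⬝ᵥ y))) := by
        rw [map_sum]
        refine Finset.sum_congr rfl fun y _ => ?_
        rw [← AddChar.map_neg_eq_conj, neg_neg]
      rw [h2, mul_comm (conj _), Complex.mul_conj, Complex.normSq_eq_norm_sq]
      push_cast
      ring
    rw [h1, Finset.sum_mul_sum, ← Finset.sum_product', Finset.sum_mul_sum, ← Finset.sum_product']
    refine Finset.sum_congr rfl fun z _ => ?_
    rw [← AddChar.map_add_eq_mul, ← AddChar.map_add_eq_mul, ← AddChar.map_add_eq_mul]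
    congr 1
    simp only [dotProduct_sub, dotProduct_add]
    ring
  have h3 : ((∑ x : Fin d → F, ‖∑ y ∈ E, χ (-(x ⬝ᵥ y))‖ ^ 4 : ℝ) : ℂ) =
      (((Fintype.card F : ℝ) ^ d * E[E] : ℝ) : ℂ) := by
    rw [Complex.ofReal_sum, Finset.sum_congr rfl fun x _ => key x, Finset.sum_comm]
    simp_rw [sum_addChar_dotProduct hχ, sub_eq_zero]
    rw [← Finset.sum_filter, Finset.sum_const, nsmul_eq_mul]
    unfold Finset.addEnergy
    push_cast
    rw [mul_comm]
  exact_mod_cast h3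

open scoped Combinatorics.Additive in
/-- A set of energy at most `C |E|^{4 - 4s}` is a `(4, s)`-Salem set. -/
theorem isSalemWith_of_addEnergy_le {F : Type*} [Field F] [Fintype F] [DecidableEq F] {d : ℕ}
    {C s : ℝ} (hC : 1 ≤ C) (E : Finset (Fin d → F))
    (hE : (E[E] : ℝ) ≤ C * (E.card : ℝ) ^ (4 - 4 * s)) : IsSalemWith C 4 s E := by
  intro χ hχ
  set Q : ℝ := (Fintype.card F : ℝ) ^ d with hQ
  have hQ0 : 0 < Q := by
    have : (0 : ℝ) < Fintype.card F := by exact_mod_cast Fintype.card_pos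
    positivity
  have hterm : ∀ x : Fin d → F, ‖fourierHat χ E x‖ ^ (4 : ℝ) =
      Q⁻¹ ^ 4 * ‖∑ y ∈ E, χ (-(x ⬝ᵥ y))‖ ^ 4 := by
    intro x
    rw [show (4 : ℝ) = ((4 : ℕ) : ℝ) by norm_num, Real.rpow_natCast, fourierHat, norm_mul, mul_pow,
      norm_inv, norm_pow, Complex.norm_natCast]
  have hsum : ∑ x ∈ Finset.univ.filter (fun x : Fin d → F => x ≠ 0), ‖fourierHat χ E x‖ ^ (4 : ℝ)
      ≤ Q⁻¹ ^ 4 * (Q * E[E]) := by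
    rw [← sum_norm_sum_addChar_pow_four hχ, Finset.mul_sum]
    simp_rw [← hterm]
    exact Finset.sum_le_sum_of_subset_of_nonneg (Finset.filter_subset _ _)
      fun x _ _ => by positivity
  have hc : (0 : ℝ) ≤ E.card := Nat.cast_nonneg _
  have hCs : C ≤ C ^ 4 := le_self_pow₀ hC (by norm_num)
  have hbound : Q⁻¹ * ∑ x ∈ Finset.univ.filter (fun x : Fin d → F => x ≠ 0),
      ‖fourierHat χ E x‖ ^ (4 : ℝ) ≤ (C * Q⁻¹ * (E.card : ℝ) ^ (1 - s)) ^ (4 : ℝ) := by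
    calc _ ≤ Q⁻¹ * (Q⁻¹ ^ 4 * (Q * E[E])) := by gcongr
      _ = Q⁻¹ ^ 4 * E[E] := by field_simp
      _ ≤ Q⁻¹ ^ 4 * (C ^ 4 * (E.card : ℝ) ^ (4 - 4 * s)) := by
          gcongr
          exact hE.trans (by gcongr)
      _ = _ := by
          rw [show 4 - 4 * s = (1 - s) * ((4 : ℕ) : ℝ) by push_cast; ring, Real.rpow_mul hc,
            show (4 : ℝ) = ((4 : ℕ) : ℝ) by norm_num, Real.rpow_natCast, Real.rpow_natCast]
          ring
  unfold fourierNorm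
  refine (Real.rpow_le_rpow (by positivity) ?_ (by norm_num)).trans_eq
    (b := ((C * Q⁻¹ * (E.card : ℝ) ^ (1 - s)) ^ (4 : ℝ)) ^ (1 / 4 : ℝ)) ?_
  · convert hbound
  · rw [← Real.rpow_mul (by positivity)]
    norm_num

/-! ### Subspaces with a hyperbolic quotient -/

/-- A similitude of `F^n` with multiplier `-1`: multiplication by a square root of `-1`, or, for
`n = 2k`, the block matrix `(a, -b; b, a)` with `a² + b² = -1`. -/
theorem exists_linearMap_sum_sq_eq_neg {F : Type*} [Field F] [Fintype F] (n : ℕ)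
    (h : Even n ∨ Fintype.card F % 4 = 1) :
    ∃ J : (Fin n → F) →ₗ[F] (Fin n → F), ∀ x, ∑ i, J x i ^ 2 = -∑ i, x i ^ 2 := by
  rcases h with ⟨k, rfl⟩ | h
  · obtain ⟨p, hp⟩ := CharP.exists F
    have := CharP.char_is_prime F p
    have : NeZero p := ⟨this.ne_zero⟩
    obtain ⟨a', b', hab⟩ := CharP.sq_add_sq F p (-1)
    obtain ⟨a, b, hab⟩ : ∃ a b : F, a ^ 2 + b ^ 2 = -1 := ⟨a', b', by simpa using hab⟩
    refine ⟨{ toFun := fun x => Fin.append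
                (fun i => a * x (Fin.castAdd k i) - b * x (Fin.natAdd k i))
                (fun i => b * x (Fin.castAdd k i) + a * x (Fin.natAdd k i))
              map_add' := fun x y => funext (Fin.addCases
                (fun i => by simp only [Fin.append_left, Pi.add_apply]; ring)
                (fun i => by simp only [Fin.append_right, Pi.add_apply]; ring))
              map_smul' := fun c x => funext (Fin.addCases
                (fun i => by
                  simp only [Fin.append_left, Pi.smul_apply, smul_eq_mul, RingHom.id_apply]; ring)
                (fun i => by
                  simp only [Fin.append_right, Pi.smul_apply, smul_eq_mul,
                    RingHom.id_apply]; ring)) }, fun x => ?_⟩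
    simp only [LinearMap.coe_mk, AddHom.coe_mk, Fin.sum_univ_add, Fin.append_left,
      Fin.append_right]
    rw [← Finset.sum_add_distrib, ← Finset.sum_add_distrib, ← Finset.sum_neg_distrib]
    refine Finset.sum_congr rfl fun i _ => ?_
    linear_combination (x (Fin.castAdd k i) ^ 2 + x (Fin.natAdd k i) ^ 2) * hab
  · obtain ⟨t, ht⟩ := FiniteField.isSquare_neg_one_iff.2 (by omega : Fintype.card F % 4 ≠ 3)
    refine ⟨t • LinearMap.id, fun x => ?_⟩
    rw [← Finset.sum_neg_distrib]
    refine Finset.sum_congr rfl fun i _ => ?_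
    simp only [LinearMap.smul_apply, LinearMap.id_apply, Pi.smul_apply, smul_eq_mul]
    linear_combination -(x i ^ 2) * ht

theorem fin_cons_add {F : Type*} [Add F] {m : ℕ} (x y : F) (v w : Fin m → F) :
    (Fin.cons (x + y) (v + w) : Fin (m + 1) → F) = Fin.cons x v + Fin.cons y w :=
  funext (Fin.cases rfl fun _ => rfl)

/-- The space `F^{2n}`, where `n = m + 1`, contains a copy of `F^{n-1} × F × F` on which the
quadratic form is `κ x y`. In odd characteristic, with `J` multiplying the form by `-1`, it
consists of the vectors `(w + y e₀, J (w - y e₀))`, where `w = (x, v)`; there `κ = 4`. In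
characteristic two it lies in the hyperplane `∑ xᵢ = 0`, where the form vanishes. -/
theorem exists_embedding_hyperbolic {F : Type*} [Field F] [Fintype F] (m : ℕ)
    (h : Even (m + 1) ∨ Fintype.card F % 4 = 1) :
    ∃ (κ : F) (φ : ((Fin m → F) × F × F) →+ (Fin ((m + 1) + (m + 1)) → F)),
      Function.Injective φ ∧ ∀ v x y, quadNorm (φ (v, x, y)) = κ * (x * y) := by
  by_cases h2 : (2 : F) = 0
  · have : CharP F 2 := CharTwo.of_one_ne_zero_of_two_eq_zero one_ne_zero h2
    -- For `m = 0` the hypothesis leaves only `q ≡ 1 mod 4`, which is odd.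
    have hm : 0 < m := by
      rcases Nat.eq_zero_or_pos m with rfl | hm
      · rcases h with h | h
        · simp at h
        · have h3 := FiniteField.even_card_of_char_two (F := F) (ringChar.eq F 2)
          omega
      · exact hm
    let i₁ : Fin m := ⟨0, hm⟩
    let φ : ((Fin m → F) × F × F) →+ (Fin ((m + 1) + (m + 1)) → F) := AddMonoidHom.mk'
      (fun p => Fin.append (Fin.cons p.2.1 p.1 : Fin (m + 1) → F)
        (Fin.cons (p.2.1 + p.2.2) (p.1 + Pi.single i₁ p.2.2) : Fin (m + 1) → F)) (by
        rintro ⟨v, x, y⟩ ⟨v', x', y'⟩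
        refine funext (Fin.addCases (fun i => ?_) (fun i => ?_))
        · simp [fin_cons_add]
        · simp only [Prod.fst_add, Prod.snd_add, Fin.append_right, Pi.add_apply, Pi.single_add]
          rw [← Pi.add_apply (Fin.cons _ _ : Fin (m + 1) → F), ← fin_cons_add]
          rw [add_add_add_comm x x', add_add_add_comm v v'])
    refine ⟨0, φ, ?_, ?_⟩
    · rw [injective_iff_map_eq_zero]
      rintro ⟨v, x, y⟩ h0
      change Fin.append (Fin.cons x v : Fin (m + 1) → F)
        (Fin.cons (x + y) (v + Pi.single i₁ y) : Fin (m + 1) → F) = 0 at h0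
      have hx : x = 0 := by simpa using congrFun h0 (Fin.castAdd (m + 1) 0)
      have hv : v = 0 := funext fun i => by simpa using congrFun h0 (Fin.castAdd (m + 1) i.succ)
      have hy : x + y = 0 := by
        have h3 := congrFun h0 (Fin.natAdd (m + 1) 0)
        rwa [Fin.append_right] at h3
      rw [hx, zero_add] at hy
      rw [hx, hv, hy]
      rfl
    · intro v x y
      change quadNorm (Fin.append (Fin.cons x v : Fin (m + 1) → F)
        (Fin.cons (x + y) (v + Pi.single i₁ y) : Fin (m + 1) → F)) = 0 * (x * y)
      rw [quadNorm, ← CharTwo.sum_sq, Fin.sum_univ_add]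
      simp only [Fin.append_left, Fin.append_right, Fin.sum_univ_succ, Fin.cons_zero,
        Fin.cons_succ, Pi.add_apply, Finset.sum_add_distrib, Finset.sum_pi_single',
        Finset.mem_univ, if_true]
      linear_combination 2 * (x + y + ∑ i, v i) ^ 2 * h2
  · obtain ⟨J, hJ⟩ := exists_linearMap_sum_sq_eq_neg (m + 1) h
    let φ : ((Fin m → F) × F × F) →+ (Fin ((m + 1) + (m + 1)) → F) := AddMonoidHom.mk'
      (fun p => Fin.append (Fin.cons (p.2.1 + p.2.2) p.1 : Fin (m + 1) → F)
        (J (Fin.cons (p.2.1 - p.2.2) p.1))) (by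
        rintro ⟨v, x, y⟩ ⟨v', x', y'⟩
        refine funext (Fin.addCases (fun i => ?_) (fun i => ?_))
        · simp only [Prod.fst_add, Prod.snd_add, Fin.append_left, Pi.add_apply]
          rw [← Pi.add_apply (Fin.cons _ _ : Fin (m + 1) → F), ← fin_cons_add]
          rw [add_add_add_comm x x']
        · simp only [Prod.fst_add, Prod.snd_add, Fin.append_right, Pi.add_apply]
          rw [← Pi.add_apply (J _), ← map_add, ← fin_cons_add]
          rw [add_sub_add_comm])
    refine ⟨4, φ, ?_, ?_⟩
    · rw [injective_iff_map_eq_zero]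
      rintro ⟨v, x, y⟩ h0
      change Fin.append (Fin.cons (x + y) v : Fin (m + 1) → F) (J (Fin.cons (x - y) v)) = 0 at h0
      have hxy : x + y = 0 := by simpa using congrFun h0 (Fin.castAdd (m + 1) 0)
      have hv : v = 0 := funext fun i => by simpa using congrFun h0 (Fin.castAdd (m + 1) i.succ)
      have hJ0 : J (Fin.cons (x - y) v) = 0 := funext fun i => by
        have h3 := congrFun h0 (Fin.natAdd (m + 1) i)
        rwa [Fin.append_right] at h3
      have hxy' := hJ (Fin.cons (x - y) v)
      rw [hJ0, hv, Fin.sum_univ_succ] at hxy'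
      have hxy'' : x - y = 0 := by simpa [Fin.sum_univ_succ] using hxy'
      have hx : x = 0 := (mul_eq_zero.1
        (by linear_combination hxy + hxy'' : 2 * x = 0)).resolve_left h2
      have hy : y = 0 := by linear_combination hxy - hx
      rw [hx, hv, hy]
      rfl
    · intro v x y
      change quadNorm (Fin.append (Fin.cons (x + y) v : Fin (m + 1) → F)
        (J (Fin.cons (x - y) v))) = 4 * (x * y)
      rw [quadNorm, Fin.sum_univ_add]
      simp only [Fin.append_left, Fin.append_right]
      rw [hJ, Fin.sum_univ_succ, Fin.sum_univ_succ]
      simp only [Fin.cons_zero, Fin.cons_succ]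
      ring

/-! ### Choice of the parameters -/

/-- The sizes `k` and `N` of the two factors. With `M = ε^{1/(2s)} q^{(d+2)/(8s)}`, where
`d = 2 (m + 1)`, they are about `M / (ε q)` and `ε q`. The bounds on `s` and `ε` say
that `1 ≤ M / (ε q) ≤ q ^ m`. -/
theorem exists_factor_sizes {m q : ℕ} (hq : 2 ≤ q) {s ε : ℝ}
    (hs1 : (((m + 1 + (m + 1) : ℕ) : ℝ) + 2) / (4 * ((m + 1 + (m + 1) : ℕ) : ℝ)) ≤ s)
    (hs2 : s ≤ 1 / 2) (hε1 : 1 / (q : ℝ) ≤ ε) (hε2 : ε ≤ 1) :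
    ∃ k N : ℕ, 0 < k ∧ 0 < N ∧ 2 * k ≤ q ^ m + 2 ∧ N < q ∧ (N : ℝ) ≤ ε * q ∧
      1 / 4 * ε ^ (1 / (2 * s)) * (q : ℝ) ^ ((((m + 1 + (m + 1) : ℕ) : ℝ) + 2) / (8 * s))
        ≤ k * N ∧
      (k * N : ℝ) ≤
        3 / 2 * ε ^ (1 / (2 * s)) * (q : ℝ) ^ ((((m + 1 + (m + 1) : ℕ) : ℝ) + 2) / (8 * s)) ∧
      (k * N : ℝ) ^ (4 * s) ≤ 9 * (N : ℝ) ^ 2 * (q : ℝ) ^ m := by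
  have hm0 : (0 : ℝ) ≤ m := Nat.cast_nonneg _
  have hs0 : 0 < s := lt_of_lt_of_le (by positivity) hs1
  rw [div_le_iff₀ (by positivity)] at hs1
  push_cast at hs1 ⊢
  set a : ℝ := 1 / (2 * s) with ha
  set b : ℝ := ((m : ℝ) + 1 + (m + 1) + 2) / (8 * s) with hb
  have hq2 : (2 : ℝ) ≤ q := by exact_mod_cast hq
  have hq0 : (0 : ℝ) < q := by linarith
  have hq1 : (1 : ℝ) ≤ q := by linarith
  have hε0 : 0 < ε := lt_of_lt_of_le (by positivity) hε1
  have hεq : 1 ≤ ε * q := by rwa [div_le_iff₀ hq0] at hε1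
  have ha1 : 1 ≤ a := by rw [ha, le_div_iff₀ (by positivity)]; linarith
  have hbm : b ≤ m + 1 := by rw [hb, div_le_iff₀ (by positivity)]; linarith
  have hab : a ≤ b := by
    rw [ha, hb, div_le_div_iff₀ (by positivity) (by positivity)]
    nlinarith
  have ha4 : a * (4 * s) = 2 := by rw [ha]; field_simp; norm_num
  have hb4 : b * (4 * s) = ((m + 2 : ℕ) : ℝ) := by rw [hb]; push_cast; field_simp; ring
  set K : ℝ := ε ^ (a - 1) * (q : ℝ) ^ (b - 1) with hK
  have hMK : ε ^ a * (q : ℝ) ^ b = K * (ε * q) := by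
    rw [hK, Real.rpow_sub_one hε0.ne', Real.rpow_sub_one hq0.ne']
    field_simp
  have hK1 : 1 ≤ K := by
    have h1 : (q : ℝ) ^ (1 - a) ≤ ε ^ (a - 1) := by
      rw [← neg_sub, Real.rpow_neg hq0.le, ← Real.inv_rpow hq0.le, ← one_div]
      exact Real.rpow_le_rpow (by positivity) hε1 (by linarith)
    calc (1 : ℝ) ≤ (q : ℝ) ^ (b - a) := Real.one_le_rpow hq1 (by linarith)
      _ = (q : ℝ) ^ (1 - a) * (q : ℝ) ^ (b - 1) := by rw [← Real.rpow_add hq0]; ring_nf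
      _ ≤ K := by rw [hK]; gcongr
  have hKq : K ≤ (q : ℝ) ^ m := by
    calc K ≤ 1 * (q : ℝ) ^ (b - 1) := by
          rw [hK]
          gcongr
          exact Real.rpow_le_one hε0.le hε2 (by linarith)
      _ ≤ (q : ℝ) ^ (m : ℝ) := by
          rw [one_mul]
          exact Real.rpow_le_rpow_of_exponent_le hq1 (by linarith)
      _ = (q : ℝ) ^ m := Real.rpow_natCast _ _
  -- For `ε = 1` the integer part of `ε q` is `q`, one more than a progression in `Fˣ` can have.
  set N : ℕ := min ⌊ε * q⌋₊ (q - 1) with hN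
  set k : ℕ := ⌈K / 2⌉₊ with hk
  have hN0 : 0 < N := lt_min (Nat.floor_pos.2 hεq) (by omega)
  have hNε : (N : ℝ) ≤ ε * q :=
    (Nat.cast_le.2 (min_le_left _ _)).trans (Nat.floor_le (by positivity))
  have hNε2 : ε * q / 2 ≤ N := by
    rw [hN, Nat.cast_min, le_min_iff]
    constructor
    · have h1 := Nat.lt_floor_add_one (ε * q)
      have h2 : (1 : ℝ) ≤ ⌊ε * q⌋₊ := by exact_mod_cast Nat.floor_pos.2 hεq
      linarith
    · rw [Nat.cast_sub (by omega), Nat.cast_one]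
      nlinarith
  have hk1 : K / 2 ≤ k := Nat.le_ceil _
  have hk2 : (k : ℝ) < K / 2 + 1 := Nat.ceil_lt_add_one (by positivity)
  have hk3 : (k : ℝ) ≤ 3 / 2 * K := by linarith
  have hupper : (k * N : ℝ) ≤ 3 / 2 * (ε ^ a * (q : ℝ) ^ b) := by
    rw [hMK]
    calc (k * N : ℝ) ≤ (3 / 2 * K) * (ε * q) := by gcongr
      _ = _ := by ring
  refine ⟨k, N, Nat.ceil_pos.2 (by positivity), hN0, ?_, ?_, hNε, ?_, ?_, ?_⟩
  · have h1 : (2 * k : ℝ) ≤ (q : ℝ) ^ m + 2 := by linarith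
    exact_mod_cast h1
  · exact lt_of_le_of_lt (min_le_right _ _) (by omega)
  · rw [mul_assoc, hMK]
    calc 1 / 4 * (K * (ε * q)) = K / 2 * (ε * q / 2) := by ring
      _ ≤ k * N := by gcongr
  · rw [mul_assoc]
    exact hupper
  · have h1 : (ε ^ a * (q : ℝ) ^ b) ^ (4 * s) = (ε * q) ^ 2 * (q : ℝ) ^ m := by
      rw [Real.mul_rpow (by positivity) (by positivity), ← Real.rpow_mul hε0.le,
        ← Real.rpow_mul hq0.le, ha4, hb4, Real.rpow_natCast, Real.rpow_ofNat]
      ring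
    have h2 : (3 / 2 : ℝ) ^ (4 * s) ≤ 9 / 4 := by
      calc (3 / 2 : ℝ) ^ (4 * s) ≤ (3 / 2 : ℝ) ^ (2 : ℝ) :=
            Real.rpow_le_rpow_of_exponent_le (by norm_num) (by linarith)
        _ = 9 / 4 := by norm_num
    have h3 : (ε * q) ^ 2 ≤ (2 * N : ℝ) ^ 2 := pow_le_pow_left₀ (by positivity) (by linarith) 2
    calc (k * N : ℝ) ^ (4 * s) ≤ (3 / 2 * (ε ^ a * (q : ℝ) ^ b)) ^ (4 * s) :=
          Real.rpow_le_rpow (by positivity) hupper (by positivity)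
      _ = (3 / 2 : ℝ) ^ (4 * s) * ((ε * q) ^ 2 * (q : ℝ) ^ m) := by
          rw [Real.mul_rpow (by norm_num) (by positivity), h1]
      _ ≤ 9 / 4 * ((2 * N) ^ 2 * (q : ℝ) ^ m) := by
          gcongr
      _ = 9 * (N : ℝ) ^ 2 * (q : ℝ) ^ m := by ring

/-! ### The construction -/

/-- The difference of two points `(gⁱ, g⁻ⁱ)` and `(gʲ, g⁻ʲ)` has product of coordinates
`2 - g^{i-j} - g^{j-i}`, which depends only on `|i - j|`. -/
theorem ncard_distanceSet_image_le {F : Type*} [Field F] [DecidableEq F] {A : Type*}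
    [AddCommGroup A] [DecidableEq A] {d : ℕ} {κ : F} (φ : (A × F × F) →+ (Fin d → F))
    (hφ : ∀ v x y, quadNorm (φ (v, x, y)) = κ * (x * y)) (S : Finset A) (g : Fˣ) (N : ℕ) :
    (distanceSet ((S ×ˢ ((Finset.range N).image (g ^ ·)).image
      (fun t : Fˣ => ((t : F), ((t⁻¹ : Fˣ) : F)))).image φ)).ncard ≤ N := by
  let D : ℕ → F := fun i => κ * (2 - (g : F) ^ i - ((g : F) ^ i)⁻¹)
  have hg : ∀ i : ℕ, (g : F) ^ i ≠ 0 := fun i => pow_ne_zero _ g.ne_zero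
  have hD : ∀ i j : ℕ, i ≤ j →
      κ * (((g : F) ^ i - (g : F) ^ j) * (((g : F) ^ i)⁻¹ - ((g : F) ^ j)⁻¹)) = D (j - i) := by
    intro i j hij
    obtain ⟨l, rfl⟩ := Nat.exists_eq_add_of_le hij
    have h1 := hg i
    have h2 := hg l
    simp only [D, Nat.add_sub_cancel_left, pow_add]
    field_simp
    ring
  have hsub : distanceSet ((S ×ˢ ((Finset.range N).image (g ^ ·)).image
      (fun t : Fˣ => ((t : F), ((t⁻¹ : Fˣ) : F)))).image φ) ⊆
      ((Finset.range N).image D : Finset F) := by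
    rintro t ⟨x, hx, y, hy, rfl⟩
    simp only [Finset.mem_image, Finset.mem_product, Finset.mem_range] at hx hy
    obtain ⟨⟨v, p⟩, ⟨_, _, ⟨i, hi, rfl⟩, rfl⟩, rfl⟩ := hx
    obtain ⟨⟨w, r⟩, ⟨_, _, ⟨j, hj, rfl⟩, rfl⟩, rfl⟩ := hy
    rw [← map_sub, Prod.mk_sub_mk, Prod.mk_sub_mk, hφ]
    simp only [Units.val_pow_eq_pow_val, Units.val_inv_eq_inv_val, Finset.coe_image,
      Finset.coe_range, Set.mem_image, Set.mem_Iio]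
    rcases le_total i j with hij | hij
    · exact ⟨j - i, by omega, (hD i j hij).symm⟩
    · exact ⟨i - j, by omega, by rw [← hD j i hij]; ring⟩
  refine (Set.ncard_le_ncard hsub (Finset.finite_toSet _)).trans ?_
  rw [Set.ncard_coe_finset]
  exact Finset.card_image_le.trans (Finset.card_range N).le

theorem proposition3p4 :
    ∃ c₁ c₂ C : ℝ, 0 < c₁ ∧ 0 < c₂ ∧ 0 < C ∧
      ∀ (d : ℕ) (s : ℝ), 0 < d → ((d : ℝ) + 2) / (4 * d) ≤ s → s ≤ 1 / 2 →
      ∀ (F : Type*) [Field F] [Fintype F],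
        (d % 4 = 0 ∨ (d % 4 = 2 ∧ Fintype.card F % 4 = 1)) →
      ∀ ε : ℝ, 1 / (Fintype.card F : ℝ) ≤ ε → ε ≤ 1 →
        ∃ E : Finset (Fin d → F),
          IsSalemWith C 4 s E ∧
          c₁ * ε ^ (1 / (2 * s)) * (Fintype.card F : ℝ) ^ (((d : ℝ) + 2) / (8 * s)) ≤ E.card ∧
          (E.card : ℝ) ≤ c₂ * ε ^ (1 / (2 * s)) *
            (Fintype.card F : ℝ) ^ (((d : ℝ) + 2) / (8 * s)) ∧
          ((distanceSet E).ncard : ℝ) ≤ ε * Fintype.card F := by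
  refine ⟨1 / 4, 3 / 2, 252, by norm_num, by norm_num, by norm_num, ?_⟩
  intro d s hd hs1 hs2 F _ _ hdF ε hε1 hε2
  classical
  obtain ⟨m, rfl⟩ : ∃ m, d = m + 1 + (m + 1) := ⟨d / 2 - 1, by omega⟩
  obtain ⟨κ, φ, hφ, hφQ⟩ := exists_embedding_hyperbolic (F := F) m (by
    rcases hdF with h | h
    · exact Or.inl (Nat.even_iff.2 (by omega))
    · exact Or.inr h.2)
  obtain ⟨k, N, hk0, hN0, hkq, hNq, hNε, hlow, hup, hpow⟩ :=
    exists_factor_sizes (m := m) Fintype.one_lt_card hs1 hs2 hε1 hε2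
  obtain ⟨g, hg⟩ := IsCyclic.exists_generator (α := Fˣ)
  have hgord : orderOf g = Fintype.card F - 1 := by
    rw [orderOf_eq_card_of_forall_mem_zpowers hg, Nat.card_eq_fintype_card, Fintype.card_units]
  have hcardA : Fintype.card (Fin m → F) = Fintype.card F ^ m := by simp
  obtain ⟨S, hSc, hSE⟩ := exists_card_eq_addEnergy_le (Fin m → F) k (by rwa [hcardA])
  rw [hcardA] at hSE
  set q := Fintype.card F with hq
  have hq0 : 0 < q := Fintype.card_pos
  set G : Finset Fˣ := (Finset.range N).image (g ^ ·) with hG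
  have hGc : G.card = N := by
    rw [hG, Finset.card_image_of_injOn, Finset.card_range]
    intro i hi j hj hij
    rw [Finset.coe_range, Set.mem_Iio] at hi hj
    exact pow_injOn_Iio_orderOf (by rw [Set.mem_Iio]; omega) (by rw [Set.mem_Iio]; omega) hij
  set f : Fˣ → F × F := fun t => ((t : F), ((t⁻¹ : Fˣ) : F)) with hf
  have hfinj : Function.Injective f := fun t u h => Units.ext (congrArg Prod.fst h)
  have hEc : ((S ×ˢ G.image f).image φ).card = k * N := by
    rw [Finset.card_image_of_injective _ hφ, Finset.card_product,
      Finset.card_image_of_injective _ hfinj, hSc, hGc]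
  refine ⟨(S ×ˢ G.image f).image φ, ?_, ?_, ?_, ?_⟩
  · apply isSalemWith_of_addEnergy_le (by norm_num)
    rw [addEnergy_image φ hφ, addEnergy_product, hEc]
    have hGE := addEnergy_hyperbola_le G
    rw [hGc] at hGE
    set ES := Finset.addEnergy S S
    set EG := Finset.addEnergy (G.image f) (G.image f)
    have hSE' : (q : ℝ) ^ m * ES ≤ 12 * (q : ℝ) ^ m * k ^ 2 + 8 * (k : ℝ) ^ 4 := by
      exact_mod_cast hSE
    have hGE' : (EG : ℝ) ≤ 3 * (N : ℝ) ^ 2 := by exact_mod_cast hGE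
    have hk1 : (1 : ℝ) ≤ k := by exact_mod_cast hk0
    have hN1 : (1 : ℝ) ≤ N := by exact_mod_cast hN0
    have he1 : (1 : ℝ) ≤ k * N := one_le_mul_of_one_le_of_one_le hk1 hN1
    have hqm : (0 : ℝ) < (q : ℝ) ^ m := by positivity
    push_cast
    set P : ℝ := (k * N : ℝ) ^ (4 - 4 * s) with hP
    have hP0 : 0 ≤ P := by positivity
    have hP1 : (k * N : ℝ) ^ 2 ≤ P := by
      rw [hP, ← Real.rpow_natCast]
      exact Real.rpow_le_rpow_of_exponent_le he1 (by push_cast; linarith)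
    have hP2 : (k * N : ℝ) ^ 4 = P * (k * N : ℝ) ^ (4 * s) := by
      rw [hP, ← Real.rpow_add (by linarith), ← Real.rpow_natCast]
      congr 1
      push_cast
      ring
    have hP3 : (k : ℝ) ^ 4 * (N : ℝ) ^ 2 ≤ 9 * P * (q : ℝ) ^ m := by
      have h1 : (N : ℝ) ^ 2 * ((k : ℝ) ^ 4 * (N : ℝ) ^ 2) ≤
          (N : ℝ) ^ 2 * (9 * P * (q : ℝ) ^ m) := by
        calc (N : ℝ) ^ 2 * ((k : ℝ) ^ 4 * (N : ℝ) ^ 2) = (k * N : ℝ) ^ 4 := by ring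
          _ ≤ P * (9 * (N : ℝ) ^ 2 * (q : ℝ) ^ m) := by rw [hP2]; gcongr
          _ = _ := by ring
      exact le_of_mul_le_mul_left h1 (by positivity)
    refine le_of_mul_le_mul_left ?_ hqm
    calc (q : ℝ) ^ m * (ES * EG) = ((q : ℝ) ^ m * ES) * EG := by ring
      _ ≤ (12 * (q : ℝ) ^ m * k ^ 2 + 8 * (k : ℝ) ^ 4) * (3 * (N : ℝ) ^ 2) := by gcongr
      _ = 36 * (q : ℝ) ^ m * (k * N) ^ 2 + 24 * ((k : ℝ) ^ 4 * (N : ℝ) ^ 2) := by ring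
      _ ≤ 36 * (q : ℝ) ^ m * P + 24 * (9 * P * (q : ℝ) ^ m) := by gcongr
      _ = (q : ℝ) ^ m * (252 * P) := by ring
  · rw [hEc, Nat.cast_mul]
    exact hlow
  · rw [hEc, Nat.cast_mul]
    exact hup
  · exact (Nat.cast_le.2 (ncard_distanceSet_image_le φ hφQ S g N)).trans hNε
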